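/- A depth-$d$ one-dimensional QAC (1D-QAC) circuit on a line of $N$ qubits is a unitary $C = L_d M_d \cdots L_1 M_1 L_0$, where each $L_k$ is a tensor product of $N$ arbitrary single-qubit unitaries and each $M_k$ is a layer of multi-qubit controlled-$Z$ gates acting on pairwise disjoint sets of qubits, each of them a nonempty interval of the line (of any length). The controlled-$Z$ gate on a set $T$ of qubits multiplies a computational basis state by $-1$ if all qubits of $T$ are $1$, and fixes it otherwise. To run the circuit on $x \in \{0,1\}^n$, the bits of $x$ are placed on $n$ distinct, arbitrarily chosen qubits of the line, the other $N-n$ (ancilla) qubits are in an arbitrary fixed pure state $|a\rangle$ independent of $x$, $C$ is applied to $|x\rangle\otimes|a\rangle$, and one fixed qubit is measured in the computational basis; the outcome is denoted $g_C(x) \in \{0,1\}$. Let $\mathrm{Majority}_n(x) = 1$ if $\sum_i x_i \ge n/2$ and $\mathrm{Majority}_n(x) = 0$ otherwise. **Theorem.** There is an absolute constant $c > 0$ such that for all integers $n, d \ge 1$, every number $N$ of qubits, and every depth-$d$ 1D-QAC circuit $C$ on $N$ qubits with $n$ input qubits (with any placement of the inputs, any ancilla state and any output qubit), $$\Pr_{x,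 C}\bigl[g_C(x) = \mathrm{Majority}_n(x)\bigr] \le 1 - c\,\sqrt{\frac1n} + 2\sqrt2\, d\cdot 2^{-n^{1/d}/6},$$ where the probability is over a uniformly random $x \in \{0,1\}^n$ and over the measurement. -/

import Mathlib

namespace OneDimQAC

/-- Computational basis strings of a register of qubits indexed by `ι`. -/
abbrev Bits (ι : Type) : Type := ι → Fin 2

/-- A layer of single-qubit unitaries on a line of `N` qubits (one unitary per qubit). -/
abbrev SingleLayer (N : ℕ) : Type := Fin N → Matrix.unitaryGroup (Fin 2) ℂ

/-- The tensor product of the single-qubit unitaries of a layer, in the computational basis. -/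
noncomputable def SingleLayer.toMatrix {N : ℕ} (L : SingleLayer N) :
    Matrix (Bits (Fin N)) (Bits (Fin N)) ℂ :=
  Matrix.of fun y x => ∏ q : Fin N, (L q : Matrix (Fin 2) (Fin 2) ℂ) (y q) (x q)

/-- A layer of multi-qubit controlled-Z gates on a line of `N` qubits, given by the supports of
its gates.  Each support is a nonempty interval of the line, and distinct gates of the layer act
on disjoint sets of qubits. -/
structure CZLayer (N : ℕ) where
  gates : Finset (Finset (Fin N))
  interval : ∀ T ∈ gates, ∃ a b : Fin N, a ≤ b ∧ T = Finset.Icc a b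
  disjoint : ∀ T ∈ gates, ∀ T' ∈ gates, T ≠ T' → Disjoint T T'

/-- The controlled-Z gate on the qubits in `T` (identity elsewhere): it negates the basis states
that are `1` on all of `T` and fixes all other basis states. -/
def czGate {N : ℕ} (T : Finset (Fin N)) : Matrix (Bits (Fin N)) (Bits (Fin N)) ℂ :=
  Matrix.diagonal fun x => if ∀ q ∈ T, x q = 1 then -1 else 1

/-- The product of the gates of a layer.  The gates are diagonal, so the product is the diagonal
matrix of the products of the diagonal entries. -/
def CZLayer.toMatrix {N : ℕ} (M : CZLayer N) : Matrix (Bits (Fin N)) (Bits (Fin N)) ℂ :=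
  Matrix.diagonal fun x => ∏ T ∈ M.gates, czGate T x x

/-- A one-dimensional QAC circuit `L_d M_d ⋯ L_1 M_1 L_0` of depth `d` on a line of `N` qubits;
the depth is the number of layers of controlled-Z gates. -/
inductive Circuit (N : ℕ) : ℕ → Type
  | base (L : SingleLayer N) : Circuit N 0
  | step {d : ℕ} (C : Circuit N d) (M : CZLayer N) (L : SingleLayer N) : Circuit N (d + 1)

/-- The unitary implemented by a circuit. -/
noncomputable def Circuit.toMatrix {N : ℕ} :
    {d : ℕ} → Circuit N d → Matrix (Bits (Fin N)) (Bits (Fin N)) ℂ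
  | _, .base L => L.toMatrix
  | _, .step C M L => L.toMatrix * M.toMatrix * C.toMatrix

/-- The ancilla qubits, when input bit `i` is placed on qubit `pos i`. -/
abbrev Ancilla {n N : ℕ} (pos : Fin n ↪ Fin N) : Type := {q : Fin N // ∀ i, pos i ≠ q}

/-- The initial state `|x⟩ ⊗ |a⟩`: input bit `i` is on qubit `pos i`, and the ancilla register is
in the state `a`. -/
noncomputable def initialState {n N : ℕ} (pos : Fin n ↪ Fin N)
    (a : EuclideanSpace ℂ (Bits (Ancilla pos))) (x : Bits (Fin n)) : Bits (Fin N) → ℂ :=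
  fun y => if ∀ i, y (pos i) = x i then a (fun q => y q) else 0

/-- The probability that measuring qubit `out` of `C (|x⟩ ⊗ |a⟩)` in the computational basis gives
the outcome `b`. -/
noncomputable def outputProb {n N d : ℕ} (C : Circuit N d) (pos : Fin n ↪ Fin N)
    (a : EuclideanSpace ℂ (Bits (Ancilla pos))) (out : Fin N) (x : Bits (Fin n)) (b : Fin 2) : ℝ :=
  ∑ y : Bits (Fin N) with y out = b, ‖(C.toMatrix.mulVec (initialState pos a x)) y‖ ^ 2

/-- The probability, over a uniformly random input and the final measurement, that the measured
output bit equals `h x`. -/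
noncomputable def successProb {n N d : ℕ} (C : Circuit N d) (pos : Fin n ↪ Fin N)
    (a : EuclideanSpace ℂ (Bits (Ancilla pos))) (out : Fin N) (h : Bits (Fin n) → Fin 2) : ℝ :=
  (∑ x : Bits (Fin n), outputProb C pos a out x (h x)) / 2 ^ n

/-- The majority function: `1` if `∑ x_i ≥ n / 2`, and `0` otherwise. -/
noncomputable def majority (n : ℕ) (x : Bits (Fin n)) : Fin 2 :=
  if (n : ℝ) / 2 ≤ ∑ i, ((x i : ℕ) : ℝ) then 1 else 0

end OneDimQAC

/-! A controlled-Z gate covering many input bits almost never fires, and once such gates are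
deleted, a circuit on a line has an output that ignores some input bit.

Fix `k` and delete from layer `j` every gate that covers more than `k * 3 ^ (j - 1)` inputs. The
light cones of the remaining circuit are controlled by input count rather than by length: for every
interval of the line it factors as `A * B`, where `A` acts inside the interval and `B` avoids an
inner interval that has lost at most `k * (3 ^ d - 1)` inputs (`Circuit.exists_isLocal_prune`).

This factorization is used twice. First, take the interval to be the support `T` of a deleted gate:
`B` leaves at least `k` input bits of `T` untouched, and the fixed unitary `A` cannot send them all
to the all-ones state, so for random `x` the all-ones weight on `T` averages at most `2 ^ (-k)`
(`sum_all_ones_weight_le`). At most `n` gates per layer are deleted, so a hybrid argument over the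
layers bounds the change in success probability by `4 * d * √(n / 2 ^ k)` (`successProb_le_prune`).
Second, take an interval on one side of the output qubit: `A` does not affect the measurement and
`B` does not see the inner inputs, so the output distribution ignores some bit
(`exists_outputProb_prune_eq`).

Every bit is pivotal for majority on at least a `1 / (2√n)` fraction of strings, and ignoring it
costs half of that (`successProb_majority_le`). Whenever the claimed bound is below 1, some `k`
makes the pruning error smaller than this loss while leaving enough inputs
(`exists_prune_parameter`). -/

namespace OneDimQAC

/-! ### Local operators on the register -/

/-- The operator `A` acts as the identity on all qubits outside `S`. -/
def IsLocal {N : ℕ} (S : Set (Fin N)) (A : Matrix (Bits (Fin N)) (Bits (Fin N)) ℂ) : Prop :=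
  (∀ y x, A y x ≠ 0 → ∀ q, q ∉ S → y q = x q) ∧
    ∀ m : Bits (Fin N), (∀ q ∈ S, m q = 0) → ∀ y x, A (y + m) (x + m) = A y x

namespace IsLocal

variable {N : ℕ} {S S' : Set (Fin N)} {A B : Matrix (Bits (Fin N)) (Bits (Fin N)) ℂ}

lemma mono (hA : IsLocal S A) (h : S ⊆ S') : IsLocal S' A :=
  ⟨fun y x hyx q hq => hA.1 y x hyx q fun hS => hq (h hS),
    fun m hm => hA.2 m fun q hq => hm q (h hq)⟩

lemma mul (hA : IsLocal S A) (hB : IsLocal S B) : IsLocal S (A * B) := by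
  refine ⟨fun y x hyx q hq => ?_, fun m hm y x => ?_⟩
  · rw [Matrix.mul_apply] at hyx
    obtain ⟨u, -, hu⟩ := Finset.exists_ne_zero_of_sum_ne_zero hyx
    exact (hA.1 y u (left_ne_zero_of_mul hu) q hq).trans (hB.1 u x (right_ne_zero_of_mul hu) q hq)
  · rw [Matrix.mul_apply, Matrix.mul_apply, ← Equiv.sum_comp (Equiv.addRight m)]
    refine Finset.sum_congr rfl fun u _ => ?_
    rw [Equiv.coe_addRight, hA.2 m hm, hB.2 m hm]

lemma apply_eq_of_agree (hA : IsLocal S A) {y x v u : Bits (Fin N)}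
    (hy : ∀ q ∈ S, y q = v q) (hx : ∀ q ∈ S, x q = u q)
    (h : ∀ q, q ∉ S → y q = x q) (h' : ∀ q, q ∉ S → v q = u q) : A y x = A v u := by
  classical
  have key := hA.2 (fun q => v q - y q) (fun q hq => by simp [hy q hq]) y x
  rw [← key]
  congr 1
  · funext q; simp
  · funext q
    by_cases hq : q ∈ S
    · simp [hy q hq, hx q hq]
    · simp [h q hq, h' q hq]

lemma commute (hA : IsLocal S A) (hB : IsLocal S' B) (h : Disjoint S S') : A * B = B * A := by
  classical
  ext y x
  rw [Matrix.mul_apply, Matrix.mul_apply]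
  have hd : ∀ q, q ∈ S → q ∉ S' := fun q hq hq' => Set.disjoint_left.mp h hq hq'
  -- `A` changes only `S` and `B` only `S'`, so each product has a single possible intermediate
  -- string: `u` for `A * B`, `v` for `B * A`.
  set u : Bits (Fin N) := fun q => if q ∈ S then x q else y q with hu
  set v : Bits (Fin N) := fun q => if q ∈ S then y q else x q with hv
  have h1 : ∀ w, w ≠ u → A y w * B w x = 0 := by
    intro w hw
    by_contra hne
    refine hw (funext fun q => ?_)
    by_cases hq : q ∈ S
    · simpa [hu, hq] using hB.1 w x (right_ne_zero_of_mul hne) q (hd q hq)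
    · simpa [hu, hq] using (hA.1 y w (left_ne_zero_of_mul hne) q hq).symm
  have h2 : ∀ w, w ≠ v → B y w * A w x = 0 := by
    intro w hw
    by_contra hne
    refine hw (funext fun q => ?_)
    by_cases hq : q ∈ S
    · simpa [hv, hq] using (hB.1 y w (left_ne_zero_of_mul hne) q (hd q hq)).symm
    · simpa [hv, hq] using hA.1 w x (right_ne_zero_of_mul hne) q hq
  rw [Finset.sum_eq_single u (fun w _ hw => h1 w hw) (by simp),
    Finset.sum_eq_single v (fun w _ hw => h2 w hw) (by simp)]
  have eA : A y u = A v x :=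
    hA.apply_eq_of_agree (fun q hq => by simp [hv, hq]) (fun q hq => by simp [hu, hq])
      (fun q hq => by simp [hu, hq]) (fun q hq => by simp [hv, hq])
  by_cases hyx : ∀ q, q ∉ S → q ∉ S' → y q = x q
  · have eB : B u x = B y v := by
      refine hB.apply_eq_of_agree (fun q hq => ?_) (fun q hq => ?_) (fun q hq => ?_)
        (fun q hq => ?_)
      · have : q ∉ S := fun h => hd q h hq
        simp [hu, this]
      · have : q ∉ S := fun h => hd q h hq
        simp [hv, this]
      · by_cases hS : q ∈ S
        · simp [hu, hS]
        · simpa [hu, hS] using hyx q hS hq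
      · by_cases hS : q ∈ S
        · simp [hv, hS]
        · simpa [hv, hS] using hyx q hS hq
    rw [eA, eB, mul_comm]
  · push Not at hyx
    obtain ⟨q, hq, hq', hne⟩ := hyx
    have z1 : B u x = 0 := by
      by_contra hz
      exact hne (by simpa [hu, hq] using hB.1 u x hz q hq')
    have z2 : B y v = 0 := by
      by_contra hz
      exact hne (by simpa [hv, hq] using hB.1 y v hz q hq')
    rw [z1, z2, mul_zero, zero_mul]

lemma diagonal {f : Bits (Fin N) → ℂ} (hf : ∀ y x, (∀ q ∈ S, y q = x q) → f y = f x) :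
    IsLocal S (Matrix.diagonal f) := by
  refine ⟨fun y x hyx q _ => ?_, fun m hm y x => ?_⟩
  · have : y = x := by
      by_contra h
      exact hyx (Matrix.diagonal_apply_ne _ h)
    rw [this]
  · simp only [Matrix.diagonal_apply, add_left_inj]
    split_ifs with h
    · exact hf _ _ fun q hq => by simp [hm q hq]
    · rfl

end IsLocal

/-! ### Unitarity of the layers and their factorization across a region -/

namespace SingleLayer

variable {N : ℕ}

lemma toMatrix_mul (L L' : SingleLayer N) :
    L.toMatrix * L'.toMatrix = SingleLayer.toMatrix (L * L') := by
  ext y x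
  simp only [toMatrix, Matrix.mul_apply, Matrix.of_apply, Pi.mul_apply,
    Matrix.UnitaryGroup.mul_apply]
  rw [Finset.prod_univ_sum, Fintype.piFinset_univ]
  exact Finset.sum_congr rfl fun u _ => Finset.prod_mul_distrib.symm

lemma toMatrix_one : SingleLayer.toMatrix (1 : SingleLayer N) = 1 := by
  ext y x
  simp only [toMatrix, Matrix.of_apply, Pi.one_apply, Matrix.UnitaryGroup.one_val]
  by_cases h : y = x
  · subst h; simp
  · obtain ⟨q, hq⟩ := Function.ne_iff.mp h
    rw [Matrix.one_apply_ne h]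
    exact Finset.prod_eq_zero (Finset.mem_univ q) (Matrix.one_apply_ne hq)

lemma star_toMatrix (L : SingleLayer N) : star L.toMatrix = SingleLayer.toMatrix (L⁻¹) := by
  ext y x
  simp [toMatrix, Matrix.star_apply, star_prod]

lemma toMatrix_mem (L : SingleLayer N) :
    L.toMatrix ∈ Matrix.unitaryGroup (Bits (Fin N)) ℂ := by
  rw [Matrix.mem_unitaryGroup_iff, star_toMatrix, toMatrix_mul, mul_inv_cancel, toMatrix_one]

lemma isLocal_toMatrix {L : SingleLayer N} {S : Set (Fin N)} (h : ∀ q, q ∉ S → L q = 1) :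
    IsLocal S L.toMatrix := by
  refine ⟨fun y x hyx q hq => ?_, fun m hm y x => ?_⟩
  · by_contra hne
    refine hyx (Finset.prod_eq_zero (Finset.mem_univ q) ?_)
    rw [h q hq]
    exact Matrix.one_apply_ne hne
  · simp only [SingleLayer.toMatrix, Matrix.of_apply, Pi.add_apply]
    refine Finset.prod_congr rfl fun q _ => ?_
    by_cases hq : q ∈ S
    · simp [hm q hq]
    · simp [h q hq, Matrix.one_apply]

lemma exists_isLocal_mul (L : SingleLayer N) (S : Set (Fin N)) :
    ∃ A ∈ Matrix.unitaryGroup (Bits (Fin N)) ℂ, ∃ B ∈ Matrix.unitaryGroup (Bits (Fin N)) ℂ,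
      IsLocal S A ∧ IsLocal Sᶜ B ∧ L.toMatrix = A * B := by
  classical
  let L₁ : SingleLayer N := fun q => if q ∈ S then L q else 1
  let L₂ : SingleLayer N := fun q => if q ∈ S then 1 else L q
  refine ⟨L₁.toMatrix, L₁.toMatrix_mem, L₂.toMatrix, L₂.toMatrix_mem,
    isLocal_toMatrix fun q hq => if_neg hq,
    isLocal_toMatrix fun q hq => if_pos (not_not.mp hq), ?_⟩
  rw [toMatrix_mul]
  congr 1
  funext q
  by_cases hq : q ∈ S <;> simp [L₁, L₂, hq]

end SingleLayer

namespace CZLayer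

variable {N : ℕ}

/-- The gates of a layer that satisfy `p`. -/
def filter (M : CZLayer N) (p : Finset (Fin N) → Prop) [DecidablePred p] : CZLayer N where
  gates := M.gates.filter p
  interval T hT := M.interval T (Finset.mem_filter.mp hT).1
  disjoint T hT T' hT' := M.disjoint T (Finset.mem_filter.mp hT).1 T' (Finset.mem_filter.mp hT').1

lemma toMatrix_filter_mul (M : CZLayer N) (p : Finset (Fin N) → Prop) [DecidablePred p] :
    (M.filter p).toMatrix * (M.filter fun T => ¬ p T).toMatrix = M.toMatrix := by
  simp only [toMatrix, Matrix.diagonal_mul_diagonal]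
  congr 1
  funext x
  exact Finset.prod_filter_mul_prod_filter_not _ _ _

lemma isLocal_toMatrix {M : CZLayer N} {S : Set (Fin N)} (h : ∀ T ∈ M.gates, (T : Set _) ⊆ S) :
    IsLocal S M.toMatrix := by
  refine IsLocal.diagonal fun y x hyx => Finset.prod_congr rfl fun T hT => ?_
  simp only [czGate, Matrix.diagonal_apply_eq]
  have : (∀ q ∈ T, y q = 1) ↔ ∀ q ∈ T, x q = 1 :=
    forall₂_congr fun q hq => by rw [hyx q (h T hT hq)]
  simp only [this]

lemma diag_eq_one_or (M : CZLayer N) (x : Bits (Fin N)) :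
    ∏ T ∈ M.gates, czGate T x x = 1 ∨ ∏ T ∈ M.gates, czGate T x x = -1 := by
  induction M.gates using Finset.induction_on with
  | empty => simp
  | insert T s hT ih =>
    rw [Finset.prod_insert hT]
    simp only [czGate, Matrix.diagonal_apply_eq] at ih ⊢
    split_ifs <;> rcases ih with ih | ih <;> simp [ih]

lemma toMatrix_mem (M : CZLayer N) :
    M.toMatrix ∈ Matrix.unitaryGroup (Bits (Fin N)) ℂ := by
  have h (x : Bits (Fin N)) :
      (∏ T ∈ M.gates, czGate T x x) * star (∏ T ∈ M.gates, czGate T x x) = 1 := by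
    rcases M.diag_eq_one_or x with h | h <;> rw [h] <;> simp
  rw [Matrix.mem_unitaryGroup_iff, toMatrix, Matrix.star_eq_conjTranspose,
    Matrix.diagonal_conjTranspose, Matrix.diagonal_mul_diagonal]
  exact (congrArg Matrix.diagonal (funext h)).trans Matrix.diagonal_one

lemma exists_isLocal_mul (M : CZLayer N) (S : Set (Fin N))
    (h : ∀ T ∈ M.gates, (T : Set _) ⊆ S ∨ (T : Set _) ⊆ Sᶜ) :
    ∃ A ∈ Matrix.unitaryGroup (Bits (Fin N)) ℂ, ∃ B ∈ Matrix.unitaryGroup (Bits (Fin N)) ℂ,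
      IsLocal S A ∧ IsLocal Sᶜ B ∧ M.toMatrix = A * B := by
  classical
  have hA : IsLocal S (M.filter fun T => (T : Set (Fin N)) ⊆ S).toMatrix :=
    isLocal_toMatrix fun T hT => (Finset.mem_filter.mp hT).2
  have hB : IsLocal Sᶜ (M.filter fun T => ¬ (T : Set (Fin N)) ⊆ S).toMatrix :=
    isLocal_toMatrix fun T hT =>
      (h T (Finset.mem_filter.mp hT).1).resolve_left (Finset.mem_filter.mp hT).2
  exact ⟨_, toMatrix_mem _, _, toMatrix_mem _, hA, hB,
    (M.toMatrix_filter_mul fun T => (T : Set (Fin N)) ⊆ S).symm⟩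

end CZLayer

lemma Circuit.toMatrix_mem {N d : ℕ} (C : Circuit N d) :
    C.toMatrix ∈ Matrix.unitaryGroup (Bits (Fin N)) ℂ := by
  induction C with
  | base L => exact L.toMatrix_mem
  | step C M L ih => exact mul_mem (mul_mem L.toMatrix_mem M.toMatrix_mem) ih

/-! ### Intervals, input counts and cuts avoiding the gates -/

/-- The qubits `l, …, r - 1` of the line. -/
def seg {N : ℕ} (l r : ℕ) : Set (Fin N) := {q | l ≤ (q : ℕ) ∧ (q : ℕ) < r}

/-- The number of input bits placed on qubits in `S`. -/
noncomputable def inputCount {n N : ℕ} (pos : Fin n ↪ Fin N) (S : Set (Fin N)) : ℕ :=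
  {i | pos i ∈ S}.ncard

section inputCount

variable {n N : ℕ} (pos : Fin n ↪ Fin N)

lemma inputCount_mono {S S' : Set (Fin N)} (h : S ⊆ S') : inputCount pos S ≤ inputCount pos S' :=
  Set.ncard_le_ncard (fun _ hi => h hi) (Set.toFinite _)

lemma inputCount_union_le (S S' : Set (Fin N)) :
    inputCount pos (S ∪ S') ≤ inputCount pos S + inputCount pos S' :=
  Set.ncard_union_le {i | pos i ∈ S} {i | pos i ∈ S'}

lemma inputCount_seg_le (l l' r r' : ℕ) :
    inputCount pos (seg l r) ≤
      inputCount pos (seg l l') + inputCount pos (seg l' r') + inputCount pos (seg r' r) := by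
  have h : (seg l r : Set (Fin N)) ⊆ seg l l' ∪ seg l' r' ∪ seg r' r := by
    intro q hq
    simp only [seg, Set.mem_union, Set.mem_ofPred_eq] at hq ⊢
    omega
  exact (inputCount_mono pos h).trans ((inputCount_union_le pos _ _).trans
    (Nat.add_le_add_right (inputCount_union_le pos _ _) _))

end inputCount

namespace CZLayer

variable {n N : ℕ} {pos : Fin n ↪ Fin N}

/-- Gates are disjoint intervals, so at most one of them straddles a given cut. Moving the cut to
the end of that gate passes over at most its own `κ` inputs. -/
lemma exists_cut_ge (M : CZLayer N) {κ : ℕ} (hM : ∀ T ∈ M.gates, inputCount pos T ≤ κ) (l : ℕ) :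
    ∃ l', l ≤ l' ∧ inputCount pos (seg l l') ≤ κ ∧
      ∀ T ∈ M.gates, (∀ q ∈ T, (q : ℕ) < l') ∨ ∀ q ∈ T, l' ≤ (q : ℕ) := by
  by_cases h : ∀ T ∈ M.gates, (∀ q ∈ T, (q : ℕ) < l) ∨ ∀ q ∈ T, l ≤ (q : ℕ)
  · refine ⟨l, le_rfl, ?_, h⟩
    have : {i | pos i ∈ (seg l l : Set (Fin N))} = ∅ := by
      ext i
      simp [seg]
    simp [inputCount, this]
  · push Not at h
    obtain ⟨T, hT, ⟨q₁, hq₁, hl₁⟩, q₂, hq₂, hl₂⟩ := h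
    obtain ⟨a, b, hab, rfl⟩ := M.interval T hT
    simp only [Finset.mem_Icc, Fin.le_def] at hq₁ hq₂ hab
    -- Any gate straddling `b + 1` contains `b`, hence meets `Icc a b`.
    refine ⟨b + 1, by omega, (inputCount_mono pos fun q hq => ?_).trans (hM _ hT), ?_⟩
    · simp only [seg, Set.mem_ofPred_eq] at hq
      simp only [Finset.coe_Icc, Set.mem_Icc, Fin.le_def]
      omega
    · intro T' hT'
      by_contra hcon
      push Not at hcon
      obtain ⟨⟨p₁, hp₁, hb₁⟩, p₂, hp₂, hb₂⟩ := hcon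
      obtain ⟨a', b', hab', rfl⟩ := M.interval T' hT'
      have hne : Finset.Icc a b ≠ Finset.Icc a' b' := by
        intro heq
        rw [← heq] at hp₁
        simp only [Finset.mem_Icc, Fin.le_def] at hp₁
        omega
      have h1 : b ∈ Finset.Icc a b := by
        simp only [Finset.mem_Icc, Fin.le_def]
        omega
      have h2 : b ∈ Finset.Icc a' b' := by
        simp only [Finset.mem_Icc, Fin.le_def] at hp₁ hp₂ ⊢
        omega
      exact Finset.disjoint_left.mp (M.disjoint _ hT _ hT' hne) h1 h2

lemma exists_cut_le (M : CZLayer N) {κ : ℕ} (hM : ∀ T ∈ M.gates, inputCount pos T ≤ κ) (r : ℕ) :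
    ∃ r', r' ≤ r ∧ inputCount pos (seg r' r) ≤ κ ∧
      ∀ T ∈ M.gates, (∀ q ∈ T, (q : ℕ) < r') ∨ ∀ q ∈ T, r' ≤ (q : ℕ) := by
  by_cases h : ∀ T ∈ M.gates, (∀ q ∈ T, (q : ℕ) < r) ∨ ∀ q ∈ T, r ≤ (q : ℕ)
  · refine ⟨r, le_rfl, ?_, h⟩
    have : {i | pos i ∈ (seg r r : Set (Fin N))} = ∅ := by
      ext i
      simp [seg]
    simp [inputCount, this]
  · push Not at h
    obtain ⟨T, hT, ⟨q₁, hq₁, hl₁⟩, q₂, hq₂, hl₂⟩ := h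
    obtain ⟨a, b, hab, rfl⟩ := M.interval T hT
    simp only [Finset.mem_Icc, Fin.le_def] at hq₁ hq₂ hab
    refine ⟨a, by omega, (inputCount_mono pos fun q hq => ?_).trans (hM _ hT), ?_⟩
    · simp only [seg, Set.mem_ofPred_eq] at hq
      simp only [Finset.coe_Icc, Set.mem_Icc, Fin.le_def]
      omega
    · intro T' hT'
      by_contra hcon
      push Not at hcon
      obtain ⟨⟨p₁, hp₁, hb₁⟩, p₂, hp₂, hb₂⟩ := hcon
      obtain ⟨a', b', hab', rfl⟩ := M.interval T' hT'
      have hne : Finset.Icc a b ≠ Finset.Icc a' b' := by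
        intro heq
        rw [← heq] at hp₂
        simp only [Finset.mem_Icc, Fin.le_def] at hp₂
        omega
      have h1 : a ∈ Finset.Icc a b := by
        simp only [Finset.mem_Icc, Fin.le_def]
        omega
      have h2 : a ∈ Finset.Icc a' b' := by
        simp only [Finset.mem_Icc, Fin.le_def] at hp₁ hp₂ ⊢
        omega
      exact Finset.disjoint_left.mp (M.disjoint _ hT _ hT' hne) h1 h2

end CZLayer

/-! ### Pruning and the light cone of a pruned circuit -/

/-- The circuit obtained by deleting, from the `j`-th layer of controlled-Z gates, all gates that
act on more than `k * 3 ^ (j - 1)` input qubits. -/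
noncomputable def Circuit.prune {n N : ℕ} (pos : Fin n ↪ Fin N) (k : ℕ) :
    {d : ℕ} → Circuit N d → Circuit N d
  | _, .base L => .base L
  | _, .step (d := d) C M L =>
    .step (C.prune pos k) (M.filter fun T => inputCount pos T ≤ k * 3 ^ d) L

/-- Induction on depth, peeling off the outermost layers. Both endpoints move inward off the gates
they cut, at a cost of at most `k * 3 ^ d` inputs per side; the layers then split across the new
interval, and the induction hypothesis is applied to it. The losses satisfy `2 * k * 3 ^ d + k * (3
^ d - 1) = k * (3 ^ (d + 1) - 1)`, whence the powers of 3 and the extra `k` on the left. -/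
theorem Circuit.exists_isLocal_prune {n N : ℕ} (pos : Fin n ↪ Fin N) (k : ℕ) {d : ℕ}
    (C : Circuit N d) (l r : ℕ) :
    ∃ l' r', l ≤ l' ∧ r' ≤ r ∧
      inputCount pos (seg l r) + k ≤ inputCount pos (seg l' r') + k * 3 ^ d ∧
      ∃ A ∈ Matrix.unitaryGroup (Bits (Fin N)) ℂ, ∃ B ∈ Matrix.unitaryGroup (Bits (Fin N)) ℂ,
        IsLocal (seg l r) A ∧ IsLocal (seg l' r')ᶜ B ∧ (C.prune pos k).toMatrix = A * B := by
  induction C generalizing l r with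
  | base L =>
    obtain ⟨A, hA, B, hB, hA', hB', h⟩ := L.exists_isLocal_mul (seg l r)
    exact ⟨l, r, le_rfl, le_rfl, by simp, A, hA, B, hB, hA', hB', h⟩
  | @step d C M L ih =>
    set M' := M.filter fun T => inputCount pos T ≤ k * 3 ^ d with hM'
    have hlight : ∀ T ∈ M'.gates, inputCount pos T ≤ k * 3 ^ d :=
      fun T hT => (Finset.mem_filter.mp hT).2
    obtain ⟨l₁, hl, hcl, hl₁⟩ := M'.exists_cut_ge hlight l
    obtain ⟨r₁, hr, hcr, hr₁⟩ := M'.exists_cut_le hlight r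
    have hsub : (seg l₁ r₁ : Set (Fin N)) ⊆ seg l r := by
      intro q hq
      simp only [seg, Set.mem_ofPred_eq] at hq ⊢
      omega
    have hgates : ∀ T ∈ M'.gates,
        (T : Set (Fin N)) ⊆ seg l₁ r₁ ∨ (T : Set (Fin N)) ⊆ (seg l₁ r₁)ᶜ := by
      intro T hT
      rcases hl₁ T hT with h1 | h1
      · refine .inr fun q hq hq' => ?_
        have := h1 q hq
        simp only [seg, Set.mem_ofPred_eq] at hq'
        omega
      · rcases hr₁ T hT with h2 | h2
        · exact .inl fun q hq => ⟨h1 q hq, h2 q hq⟩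
        · refine .inr fun q hq hq' => ?_
          have := h2 q hq
          simp only [seg, Set.mem_ofPred_eq] at hq'
          omega
    obtain ⟨l₂, r₂, hl₂, hr₂, hc, A, hA, B, hB, hA', hB', h⟩ := ih l₁ r₁
    obtain ⟨A₁, hA₁, B₁, hB₁, hA₁', hB₁', h₁⟩ := M'.exists_isLocal_mul (seg l₁ r₁) hgates
    obtain ⟨A₂, hA₂, B₂, hB₂, hA₂', hB₂', h₂⟩ := L.exists_isLocal_mul (seg l₁ r₁)
    have hsub₂ : (seg l₂ r₂ : Set (Fin N)) ⊆ seg l₁ r₁ := by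
      intro q hq
      simp only [seg, Set.mem_ofPred_eq] at hq ⊢
      omega
    refine ⟨l₂, r₂, hl.trans hl₂, hr₂.trans hr, ?_, A₂ * A₁ * A, mul_mem (mul_mem hA₂ hA₁) hA,
      B₂ * B₁ * B, mul_mem (mul_mem hB₂ hB₁) hB, ((hA₂'.mul hA₁').mul hA').mono hsub,
      ((hB₂'.mul hB₁').mono (Set.compl_subset_compl.mpr hsub₂)).mul hB', ?_⟩
    · have := inputCount_seg_le pos l l₁ r r₁
      rw [pow_succ, ← mul_assoc]
      omega
    -- Outer factors of later layers commute past the inner factors of earlier ones, which collects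
    -- the inner factors on the left.
    · have c1 : B₂ * A₁ = A₁ * B₂ := (hA₁'.commute hB₂' disjoint_compl_right).symm
      have c2 : (B₂ * B₁) * A = A * (B₂ * B₁) :=
        (hA'.commute (hB₂'.mul hB₁') disjoint_compl_right).symm
      change L.toMatrix * M'.toMatrix * (C.prune pos k).toMatrix = _
      calc L.toMatrix * M'.toMatrix * (C.prune pos k).toMatrix
          = A₂ * (B₂ * A₁) * B₁ * (A * B) := by rw [h, h₁, h₂]; noncomm_ring
        _ = A₂ * A₁ * ((B₂ * B₁) * A) * B := by rw [c1]; noncomm_ring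
        _ = A₂ * A₁ * A * (B₂ * B₁ * B) := by rw [c2]; noncomm_ring

/-! ### Norms of states and the initial state -/

/-- The Euclidean norm of a state vector. -/
noncomputable def l2norm {ι : Type} [Fintype ι] (v : ι → ℂ) : ℝ :=
  ‖(WithLp.toLp 2 v : EuclideanSpace ℂ ι)‖

section l2norm

variable {ι : Type} [Fintype ι]

lemma l2norm_nonneg (v : ι → ℂ) : 0 ≤ l2norm v := norm_nonneg _

lemma l2norm_sq (v : ι → ℂ) : l2norm v ^ 2 = ∑ y, ‖v y‖ ^ 2 :=
  EuclideanSpace.norm_sq_eq _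

lemma l2norm_add_le (u v : ι → ℂ) : l2norm (u + v) ≤ l2norm u + l2norm v := by
  simpa [l2norm, WithLp.toLp_add] using
    norm_add_le (WithLp.toLp 2 u : EuclideanSpace ℂ ι) (WithLp.toLp 2 v)

lemma l2norm_le_of_le {u v : ι → ℂ} (h : ∀ y, ‖u y‖ ≤ ‖v y‖) : l2norm u ≤ l2norm v := by
  refine (sq_le_sq₀ (l2norm_nonneg u) (l2norm_nonneg v)).mp ?_
  rw [l2norm_sq, l2norm_sq]
  exact Finset.sum_le_sum fun y _ => pow_le_pow_left₀ (norm_nonneg _) (h y) 2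

lemma ofReal_l2norm_sq (v : ι → ℂ) : ((l2norm v ^ 2 : ℝ) : ℂ) = star v ⬝ᵥ v := by
  rw [l2norm_sq, dotProduct]
  push_cast
  exact Finset.sum_congr rfl fun y _ => (Complex.conj_mul' (v y)).symm

lemma l2norm_mulVec [DecidableEq ι] {U : Matrix ι ι ℂ} (hU : U ∈ Matrix.unitaryGroup ι ℂ)
    (v : ι → ℂ) : l2norm (U.mulVec v) = l2norm v := by
  have h : l2norm (U.mulVec v) ^ 2 = l2norm v ^ 2 := by
    have : ((l2norm (U.mulVec v) ^ 2 : ℝ) : ℂ) = ((l2norm v ^ 2 : ℝ) : ℂ) := by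
      rw [ofReal_l2norm_sq, ofReal_l2norm_sq, Matrix.star_mulVec, ← Matrix.dotProduct_mulVec,
        Matrix.mulVec_mulVec, ← Matrix.star_eq_conjTranspose,
        Matrix.mem_unitaryGroup_iff'.mp hU, Matrix.one_mulVec]
    exact_mod_cast this
  exact (sq_eq_sq₀ (l2norm_nonneg _) (l2norm_nonneg _)).mp h

lemma sum_norm_sq_row [DecidableEq ι] {U : Matrix ι ι ℂ} (hU : U ∈ Matrix.unitaryGroup ι ℂ)
    (y : ι) : ∑ u, ‖U y u‖ ^ 2 = 1 := by
  have h := congrFun (congrFun (Matrix.mem_unitaryGroup_iff.mp hU) y) y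
  rw [Matrix.mul_apply, Matrix.one_apply_eq] at h
  have h' : ((∑ u, ‖U y u‖ ^ 2 : ℝ) : ℂ) = 1 := by
    rw [← h]
    push_cast
    exact Finset.sum_congr rfl fun u _ => (Complex.mul_conj' (U y u)).symm
  exact_mod_cast h'

end l2norm

section initialState

variable {n N : ℕ} {pos : Fin n ↪ Fin N}

lemma l2norm_initialState (a : EuclideanSpace ℂ (Bits (Ancilla pos))) (x : Bits (Fin n)) :
    l2norm (initialState pos a x) = ‖a‖ := by
  classical
  refine (sq_eq_sq₀ (l2norm_nonneg _) (norm_nonneg _)).mp ?_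
  rw [l2norm_sq, EuclideanSpace.norm_sq_eq]
  have h : ∀ y, ‖initialState pos a x y‖ ^ 2 =
      if ∀ i, y (pos i) = x i then ‖a fun q => y q‖ ^ 2 else 0 := by
    intro y
    simp only [initialState]
    split_ifs <;> simp
  rw [Finset.sum_congr rfl fun y _ => h y, ← Finset.sum_filter]
  refine Finset.sum_nbij' (fun y q => y q)
    (fun z q => if h : ∃ i, pos i = q then x h.choose else z ⟨q, fun i hi => h ⟨i, hi⟩⟩)
    (fun _ _ => Finset.mem_univ _) (fun z _ => ?_) (fun y hy => ?_) (fun z _ => ?_)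
    (fun _ _ => rfl)
  · rw [Finset.mem_filter]
    refine ⟨Finset.mem_univ _, fun i => ?_⟩
    have h : ∃ j, pos j = pos i := ⟨i, rfl⟩
    exact (dif_pos h).trans (by rw [pos.injective h.choose_spec])
  · rw [Finset.mem_filter] at hy
    funext q
    by_cases h : ∃ i, pos i = q
    · rw [dif_pos h, ← hy.2, h.choose_spec]
    · rw [dif_neg h]
  · funext q
    exact dif_neg fun ⟨i, hi⟩ => q.2 i hi

/-- An operator that avoids `K` leaves the input bits stored on `K` readable in every basis state of
the support. -/
lemma mulVec_initialState_ne_zero {B : Matrix (Bits (Fin N)) (Bits (Fin N)) ℂ} {K : Set (Fin N)}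
    (hB : IsLocal Kᶜ B) (a : EuclideanSpace ℂ (Bits (Ancilla pos))) {x : Bits (Fin n)}
    {y : Bits (Fin N)} (hy : B.mulVec (initialState pos a x) y ≠ 0) {i : Fin n} (hi : pos i ∈ K) :
    y (pos i) = x i := by
  obtain ⟨u, -, hu⟩ := Finset.exists_ne_zero_of_sum_ne_zero hy
  have h1 := hB.1 y u (left_ne_zero_of_mul hu) (pos i) (fun h => h hi)
  have h2 := right_ne_zero_of_mul hu
  simp only [initialState] at h2
  rw [h1]
  by_contra hne
  exact h2 (if_neg fun h => hne (h i))

end initialState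

lemma card_filter_agree {n : ℕ} (J : Set (Fin n)) [DecidablePred (· ∈ J)] (v : Bits (Fin n)) :
    (Finset.univ.filter fun x : Bits (Fin n) => ∀ i ∈ J, v i = x i).card * 2 ^ J.ncard = 2 ^ n := by
  classical
  have h : (Finset.univ.filter fun x : Bits (Fin n) => ∀ i ∈ J, v i = x i) =
      Fintype.piFinset fun i => if i ∈ J then {v i} else Finset.univ := by
    ext x
    simp only [Finset.mem_filter, Finset.mem_univ, true_and, Fintype.mem_piFinset]
    refine forall_congr' fun i => ?_
    by_cases hi : i ∈ J <;> simp [hi, eq_comm]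
  have h2 : 2 ^ J.ncard = ∏ i : Fin n, if i ∈ J then 2 else 1 := by
    rw [Finset.prod_ite, Finset.prod_const, Finset.prod_const_one, mul_one,
      Set.ncard_eq_toFinset_card']
    congr 2
    ext i
    simp
  rw [h, Fintype.card_piFinset, h2, ← Finset.prod_mul_distrib]
  have : ∀ i : Fin n, ((if i ∈ J then {v i} else Finset.univ : Finset (Fin 2)).card *
      if i ∈ J then 2 else 1) = 2 := by
    intro i
    by_cases hi : i ∈ J <;> simp [hi]
  simp [this]

/-! ### Heavy gates rarely fire -/

/-- Averaged over the input, the projection of `A φ_x` onto the all-ones states of `T` has small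
weight if `A` is local to `T` and `φ_x` stores many input bits on `T`. -/
lemma sum_all_ones_weight_le {n N : ℕ} {pos : Fin n ↪ Fin N} {T : Finset (Fin N)}
    {K : Set (Fin N)} (hKT : K ⊆ T) {A : Matrix (Bits (Fin N)) (Bits (Fin N)) ℂ}
    (hA : A ∈ Matrix.unitaryGroup (Bits (Fin N)) ℂ) (hA' : IsLocal (T : Set (Fin N)) A)
    {φ : Bits (Fin n) → Bits (Fin N) → ℂ} (hφ : ∀ x, l2norm (φ x) ≤ 1)
    (hsupp : ∀ x y, φ x y ≠ 0 → ∀ i, pos i ∈ K → y (pos i) = x i) :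
    (∑ x, ∑ y : Bits (Fin N) with ∀ q ∈ T, y q = 1, ‖A.mulVec (φ x) y‖ ^ 2) *
      2 ^ inputCount pos K ≤ 2 ^ n := by
  classical
  -- `W x` is the mass that the all-ones row of `A` puts on strings storing `x` on `K`.
  set W : Bits (Fin n) → ℝ := fun x =>
    ∑ u : Bits (Fin N), if ∀ i, pos i ∈ K → u (pos i) = x i then ‖A 1 u‖ ^ 2 else 0 with hW
  have hW0 : ∀ x, 0 ≤ W x := fun x => Finset.sum_nonneg fun u _ => by split_ifs <;> positivity
  have hrow : ∀ x, ∀ y : Bits (Fin N), (∀ q ∈ T, y q = 1) → ‖A.mulVec (φ x) y‖ ^ 2 ≤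
      W x * ∑ u, if ∀ q, q ∉ T → y q = u q then ‖φ x u‖ ^ 2 else 0 := by
    intro x y hy
    -- Translation by `1 - y`, which vanishes on `T`, carries row `y` to row `1`, so the same `W x`
    -- serves every `y` that is all ones on `T`.
    have hWy : W x =
        ∑ u : Bits (Fin N), if ∀ i, pos i ∈ K → u (pos i) = x i then ‖A y u‖ ^ 2 else 0 := by
      refine (Equiv.sum_comp (Equiv.addRight (1 - y)) _).symm.trans
        (Finset.sum_congr rfl fun u _ => ?_)
      have hm : ∀ q ∈ (T : Set (Fin N)), (1 - y) q = 0 := fun q hq => by simp [hy q hq]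
      have h1 : A 1 (u + (1 - y)) = A y u := by
        have := hA'.2 (1 - y) hm y u
        rwa [add_sub_cancel] at this
      have h2 : (∀ i, pos i ∈ K → (u + (1 - y)) (pos i) = x i) ↔
          ∀ i, pos i ∈ K → u (pos i) = x i :=
        forall₂_congr fun i hi => by rw [Pi.add_apply, hm _ (hKT hi), add_zero]
      simp only [Equiv.coe_addRight, h1, h2]
    have hle : ‖A.mulVec (φ x) y‖ ≤
        ∑ u : Bits (Fin N), (if ∀ i, pos i ∈ K → u (pos i) = x i then ‖A y u‖ else 0) *
          if ∀ q, q ∉ T → y q = u q then ‖φ x u‖ else 0 := by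
      refine (norm_sum_le _ _).trans (Finset.sum_le_sum fun u _ => ?_)
      rw [norm_mul]
      by_cases hAu : A y u = 0
      · simp [hAu]
      by_cases hu : φ x u = 0
      · simp [hu]
      have h : ∀ q, q ∉ T → y q = u q := fun q hq => hA'.1 y u hAu q hq
      rw [if_pos (hsupp x u hu), if_pos h]
    rw [hWy]
    refine (pow_le_pow_left₀ (norm_nonneg _) hle 2).trans
      ((Finset.sum_mul_sq_le_sq_mul_sq _ _ _).trans_eq ?_)
    simp only [ite_pow, ne_eq, OfNat.ofNat_ne_zero, not_false_eq_true, zero_pow]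
  have hcol : ∀ x, ∑ y : Bits (Fin N) with ∀ q ∈ T, y q = 1,
      ∑ u, (if ∀ q, q ∉ T → y q = u q then ‖φ x u‖ ^ 2 else 0) ≤ 1 := by
    intro x
    have hx : ∑ u, ‖φ x u‖ ^ 2 ≤ 1 := by
      rw [← l2norm_sq]
      exact pow_le_one₀ (l2norm_nonneg _) (hφ x)
    rw [Finset.sum_comm]
    refine (Finset.sum_le_sum fun u _ => ?_).trans hx
    rw [← Finset.sum_filter, Finset.sum_const, nsmul_eq_mul]
    refine mul_le_of_le_one_left (by positivity) ?_
    -- Such a `y` is forced: it is all ones on `T` and equals `u` elsewhere.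
    have : (Finset.filter (fun y : Bits (Fin N) => ∀ q, q ∉ T → y q = u q)
        (Finset.univ.filter fun y => ∀ q ∈ T, y q = 1)).card ≤ 1 := by
      refine Finset.card_le_one.mpr fun y hy z hz => funext fun q => ?_
      simp only [Finset.mem_filter, Finset.mem_univ, true_and] at hy hz
      by_cases hq : q ∈ T
      · rw [hy.1 q hq, hz.1 q hq]
      · rw [hy.2 q hq, hz.2 q hq]
    exact_mod_cast this
  -- Each `u` is compatible with a `2 ^ (-inputCount pos K)` fraction of the inputs, and a row of a
  -- unitary has norm 1.
  have hWsum : (∑ x, W x) * 2 ^ inputCount pos K = 2 ^ n := by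
    rw [hW, Finset.sum_comm, Finset.sum_mul]
    have h : ∀ u : Bits (Fin N),
        (∑ x : Bits (Fin n), if ∀ i, pos i ∈ K → u (pos i) = x i then ‖A 1 u‖ ^ 2 else 0) *
          2 ^ inputCount pos K = 2 ^ n * ‖A 1 u‖ ^ 2 := by
      intro u
      have := card_filter_agree {i | pos i ∈ K} fun i => u (pos i)
      rw [← Finset.sum_filter, Finset.sum_const, nsmul_eq_mul, mul_right_comm]
      congr 1
      exact_mod_cast this
    rw [Finset.sum_congr rfl fun u _ => h u, ← Finset.mul_sum, sum_norm_sq_row hA, mul_one]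
  refine le_trans (mul_le_mul_of_nonneg_right (Finset.sum_le_sum fun x _ => ?_) (by positivity))
    hWsum.le
  calc ∑ y : Bits (Fin N) with ∀ q ∈ T, y q = 1, ‖A.mulVec (φ x) y‖ ^ 2
      ≤ ∑ y : Bits (Fin N) with ∀ q ∈ T, y q = 1,
          W x * ∑ u, if ∀ q, q ∉ T → y q = u q then ‖φ x u‖ ^ 2 else 0 :=
        Finset.sum_le_sum fun y hy => hrow x y (Finset.mem_filter.mp hy).2
    _ ≤ W x := by
        rw [← Finset.mul_sum]
        exact mul_le_of_le_one_right (hW0 x) (hcol x)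

section heavy

variable {n N : ℕ} {pos : Fin n ↪ Fin N}

/-- The layer is a diagonal of signs that can differ from 1, by `-2`, only where some gate fires.
Summing over the gates is a union bound. -/
lemma CZLayer.norm_mulVec_sub_sq_le (M : CZLayer N) (v : Bits (Fin N) → ℂ) :
    l2norm (M.toMatrix.mulVec v - v) ^ 2 ≤
      4 * ∑ T ∈ M.gates, ∑ y : Bits (Fin N) with ∀ q ∈ T, y q = 1, ‖v y‖ ^ 2 := by
  have hswap : ∑ T ∈ M.gates, ∑ y : Bits (Fin N) with ∀ q ∈ T, y q = 1, ‖v y‖ ^ 2 =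
      ∑ y : Bits (Fin N), ∑ T ∈ M.gates, if ∀ q ∈ T, y q = 1 then ‖v y‖ ^ 2 else 0 := by
    rw [Finset.sum_comm]
    exact Finset.sum_congr rfl fun T _ => Finset.sum_filter _ _
  rw [l2norm_sq, hswap, Finset.mul_sum]
  refine Finset.sum_le_sum fun y _ => ?_
  have hy : (M.toMatrix.mulVec v - v) y = ((∏ T ∈ M.gates, czGate T y y) - 1) * v y := by
    rw [Pi.sub_apply, CZLayer.toMatrix, Matrix.mulVec_diagonal, sub_mul, one_mul]
  have hnn : ∀ T ∈ M.gates, 0 ≤ if ∀ q ∈ T, y q = 1 then ‖v y‖ ^ 2 else 0 :=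
    fun T _ => by split_ifs <;> positivity
  rw [hy]
  by_cases h : ∃ T ∈ M.gates, ∀ q ∈ T, y q = 1
  · obtain ⟨T, hT, hTy⟩ := h
    have h1 : ‖v y‖ ^ 2 ≤ ∑ T ∈ M.gates, if ∀ q ∈ T, y q = 1 then ‖v y‖ ^ 2 else 0 := by
      refine le_trans (le_of_eq ?_) (Finset.single_le_sum hnn hT)
      rw [if_pos hTy]
    have h2 : ‖(∏ T ∈ M.gates, czGate T y y) - 1‖ ^ 2 ≤ 4 := by
      rcases M.diag_eq_one_or y with h | h <;> rw [h] <;> norm_num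
    rw [norm_mul, mul_pow]
    exact mul_le_mul h2 h1 (by positivity) (by norm_num)
  · have : ∏ T ∈ M.gates, czGate T y y = 1 := by
      refine Finset.prod_eq_one fun T hT => ?_
      rw [czGate, Matrix.diagonal_apply_eq, if_neg fun hTy => h ⟨T, hT, hTy⟩]
    rw [this, sub_self, zero_mul, norm_zero, zero_pow two_ne_zero]
    exact mul_nonneg (by norm_num) (Finset.sum_nonneg hnn)

lemma CZLayer.card_gates_le (M : CZLayer N) (hM : ∀ T ∈ M.gates, 0 < inputCount pos T) :
    M.gates.card ≤ n := by
  classical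
  have hex : ∀ T : Finset (Fin N), T ∈ M.gates → ∃ i, pos i ∈ T := by
    intro T hT
    obtain ⟨i, hi⟩ := Set.nonempty_of_ncard_ne_zero (hM T hT).ne'
    exact ⟨i, hi⟩
  choose f hf using hex
  have h := Finset.card_le_card_of_injOn (s := M.gates.attach) (t := Finset.univ)
    (fun T => f T.1 T.2) (fun _ _ => Finset.mem_univ _) (by
      intro T _ T' _ hTT'
      by_contra hne
      have hd := M.disjoint T.1 T.2 T'.1 T'.2 fun h => hne (Subtype.ext h)
      refine Finset.disjoint_left.mp hd (hf T.1 T.2) ?_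
      have := hf T'.1 T'.2
      simp only at hTT'
      rwa [← hTT'] at this)
  simpa using h

/-- With `T` as the interval, the light cone loses at most `k * 3 ^ d - k` inputs, so a gate above
the threshold still has `k` inputs that `B` does not touch. -/
lemma Circuit.sum_gate_weight_le {d : ℕ} (C : Circuit N d) (k : ℕ)
    (a : EuclideanSpace ℂ (Bits (Ancilla pos))) (ha : ‖a‖ = 1) {T : Finset (Fin N)}
    (hT : ∃ u v : Fin N, u ≤ v ∧ T = Finset.Icc u v) (hTk : k * 3 ^ d < inputCount pos T) :
    ∑ x, ∑ y : Bits (Fin N) with ∀ q ∈ T, y q = 1,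
      ‖(C.prune pos k).toMatrix.mulVec (initialState pos a x) y‖ ^ 2 ≤ 2 ^ n / 2 ^ k := by
  obtain ⟨u, v, huv, rfl⟩ := hT
  have hseg : ((Finset.Icc u v : Finset (Fin N)) : Set (Fin N)) = seg (u : ℕ) (v + 1) := by
    ext q
    simp only [Finset.coe_Icc, Set.mem_Icc, Fin.le_def, seg, Set.mem_ofPred_eq]
    omega
  obtain ⟨l, r, hl, hr, hc, A, hA, B, hB, hA', hB', h⟩ := C.exists_isLocal_prune pos k u (v + 1)
  rw [← hseg] at hA' hc
  have hsub : (seg l r : Set (Fin N)) ⊆ (Finset.Icc u v : Finset (Fin N)) := by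
    rw [hseg]
    intro q hq
    simp only [seg, Set.mem_ofPred_eq] at hq ⊢
    omega
  have key := sum_all_ones_weight_le (pos := pos) hsub hA hA'
    (φ := fun x => B.mulVec (initialState pos a x))
    (fun x => by rw [l2norm_mulVec hB, l2norm_initialState, ha])
    (fun x y hy i hi => mulVec_initialState_ne_zero hB' a hy hi)
  simp only [Matrix.mulVec_mulVec, ← h] at key
  rw [le_div_iff₀ (by positivity)]
  refine le_trans (mul_le_mul_of_nonneg_left ?_ (by positivity)) key
  exact pow_le_pow_right₀ (by norm_num) (by omega)

lemma Circuit.sum_heavy_le {d : ℕ} (C : Circuit N d) (M : CZLayer N) (k : ℕ)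
    (a : EuclideanSpace ℂ (Bits (Ancilla pos))) (ha : ‖a‖ = 1) :
    ∑ x, l2norm ((M.filter fun T => ¬ inputCount pos T ≤ k * 3 ^ d).toMatrix.mulVec
        ((C.prune pos k).toMatrix.mulVec (initialState pos a x)) -
          (C.prune pos k).toMatrix.mulVec (initialState pos a x)) ≤
      2 ^ n * (2 * √(n / 2 ^ k)) := by
  set M' := M.filter fun T => ¬ inputCount pos T ≤ k * 3 ^ d with hM'
  set φ : Bits (Fin n) → Bits (Fin N) → ℂ :=
    fun x => (C.prune pos k).toMatrix.mulVec (initialState pos a x) with hφ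
  have hheavy : ∀ T ∈ M'.gates, k * 3 ^ d < inputCount pos T := fun T hT =>
    not_le.mp (Finset.mem_filter.mp hT).2
  have hcard : (M'.gates.card : ℝ) ≤ n := by
    exact_mod_cast M'.card_gates_le fun T hT => (Nat.zero_le _).trans_lt (hheavy T hT)
  have hsq : ∑ x, l2norm (M'.toMatrix.mulVec (φ x) - φ x) ^ 2 ≤ 4 * (n * (2 ^ n / 2 ^ k)) := by
    calc ∑ x, l2norm (M'.toMatrix.mulVec (φ x) - φ x) ^ 2
        ≤ ∑ x, 4 * ∑ T ∈ M'.gates, ∑ y : Bits (Fin N) with ∀ q ∈ T, y q = 1, ‖φ x y‖ ^ 2 :=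
          Finset.sum_le_sum fun x _ => M'.norm_mulVec_sub_sq_le _
      _ = 4 * ∑ T ∈ M'.gates, ∑ x, ∑ y : Bits (Fin N) with ∀ q ∈ T, y q = 1, ‖φ x y‖ ^ 2 := by
          rw [← Finset.mul_sum, Finset.sum_comm]
      _ ≤ 4 * ∑ T ∈ M'.gates, (2 ^ n / 2 ^ k : ℝ) := by
          refine mul_le_mul_of_nonneg_left (Finset.sum_le_sum fun T hT => ?_) (by norm_num)
          exact C.sum_gate_weight_le k a ha (M'.interval T hT) (hheavy T hT)
      _ ≤ 4 * (n * (2 ^ n / 2 ^ k)) := by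
          rw [Finset.sum_const, nsmul_eq_mul]
          gcongr
  -- Cauchy–Schwarz over the `2 ^ n` inputs turns the mean square bound into a bound on the mean.
  refine le_of_sq_le_sq ?_ (by positivity)
  calc (∑ x, l2norm (M'.toMatrix.mulVec (φ x) - φ x)) ^ 2
      ≤ Fintype.card (Bits (Fin n)) * ∑ x, l2norm (M'.toMatrix.mulVec (φ x) - φ x) ^ 2 :=
        sq_sum_le_card_mul_sum_sq
    _ ≤ 2 ^ n * (4 * (n * (2 ^ n / 2 ^ k))) := by
        have : (Fintype.card (Bits (Fin n)) : ℝ) = 2 ^ n := by simp [Bits]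
        rw [this]
        gcongr
    _ = (2 ^ n * (2 * √(n / 2 ^ k))) ^ 2 := by
        rw [mul_pow, mul_pow, Real.sq_sqrt (by positivity)]
        ring

/-- Pruning changes the final state little, on average over the inputs. -/
theorem Circuit.sum_prune_sub_le {d : ℕ} (C : Circuit N d) (k : ℕ)
    (a : EuclideanSpace ℂ (Bits (Ancilla pos))) (ha : ‖a‖ = 1) :
    ∑ x, l2norm (C.toMatrix.mulVec (initialState pos a x) -
        (C.prune pos k).toMatrix.mulVec (initialState pos a x)) ≤
      d * (2 ^ n * (2 * √(n / 2 ^ k))) := by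
  induction C with
  | base L => simp [Circuit.prune, l2norm]
  | @step d C M L ih =>
    have hstep : ∀ x, l2norm ((Circuit.step C M L).toMatrix.mulVec (initialState pos a x) -
        ((Circuit.step C M L).prune pos k).toMatrix.mulVec (initialState pos a x)) ≤
        l2norm (C.toMatrix.mulVec (initialState pos a x) -
          (C.prune pos k).toMatrix.mulVec (initialState pos a x)) +
        l2norm ((M.filter fun T => ¬ inputCount pos T ≤ k * 3 ^ d).toMatrix.mulVec
          ((C.prune pos k).toMatrix.mulVec (initialState pos a x)) -
            (C.prune pos k).toMatrix.mulVec (initialState pos a x)) := by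
      intro x
      set ψ := initialState pos a x
      set M₁ := M.filter fun T => inputCount pos T ≤ k * 3 ^ d with hM₁
      set M₂ := M.filter fun T => ¬ inputCount pos T ≤ k * 3 ^ d with hM₂
      have hM : M₁.toMatrix * M₂.toMatrix = M.toMatrix := M.toMatrix_filter_mul _
      -- Hybrid step: the old error is carried by the full layer, and the deleted gates are charged
      -- on the state of the pruned prefix, the one for which the light cone bound is available.
      have hdecomp : (Circuit.step C M L).toMatrix.mulVec ψ -
          ((Circuit.step C M L).prune pos k).toMatrix.mulVec ψ =
          (L.toMatrix * M.toMatrix).mulVec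
            (C.toMatrix.mulVec ψ - (C.prune pos k).toMatrix.mulVec ψ) +
          (L.toMatrix * M₁.toMatrix).mulVec
            (M₂.toMatrix.mulVec ((C.prune pos k).toMatrix.mulVec ψ) -
              (C.prune pos k).toMatrix.mulVec ψ) := by
        have h1 : (Circuit.step C M L).toMatrix = L.toMatrix * M.toMatrix * C.toMatrix := rfl
        have h2 : ((Circuit.step C M L).prune pos k).toMatrix =
          L.toMatrix * M₁.toMatrix * (C.prune pos k).toMatrix := rfl
        rw [h1, h2, Matrix.mulVec_sub, Matrix.mulVec_sub]
        simp only [Matrix.mulVec_mulVec, ← hM, mul_assoc]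
        abel
      rw [hdecomp]
      refine (l2norm_add_le _ _).trans_eq ?_
      rw [l2norm_mulVec (mul_mem L.toMatrix_mem M.toMatrix_mem),
        l2norm_mulVec (mul_mem L.toMatrix_mem M₁.toMatrix_mem)]
    refine (Finset.sum_le_sum fun x _ => hstep x).trans ?_
    rw [Finset.sum_add_distrib]
    push_cast
    linarith [C.sum_heavy_le M k a ha]

end heavy

/-! ### The output distribution before and after pruning -/

section output

variable {n N d : ℕ}

lemma sum_filter_norm_sq {ι : Type} [Fintype ι] (p : ι → Prop) [DecidablePred p] (v : ι → ℂ) :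
    ∑ y with p y, ‖v y‖ ^ 2 = l2norm (fun y => if p y then v y else 0) ^ 2 := by
  rw [l2norm_sq, Finset.sum_filter]
  exact Finset.sum_congr rfl fun y _ => by split_ifs <;> simp

/-- A difference of squares of projected norms: the sum of the two norms is at most 2, and their
difference at most `l2norm (u - v)`. -/
lemma sum_filter_norm_sq_le {ι : Type} [Fintype ι] (p : ι → Prop) [DecidablePred p]
    {u v : ι → ℂ} (hu : l2norm u = 1) (hv : l2norm v = 1) :
    ∑ y with p y, ‖u y‖ ^ 2 ≤ ∑ y with p y, ‖v y‖ ^ 2 + 2 * l2norm (u - v) := by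
  rw [sum_filter_norm_sq, sum_filter_norm_sq]
  set u' : ι → ℂ := fun y => if p y then u y else 0
  set v' : ι → ℂ := fun y => if p y then v y else 0
  have hu' : l2norm u' ≤ 1 := hu ▸ l2norm_le_of_le fun y => by
    simp only [u']; split_ifs <;> simp
  have hv' : l2norm v' ≤ 1 := hv ▸ l2norm_le_of_le fun y => by
    simp only [v']; split_ifs <;> simp
  have hd : l2norm (u' - v') ≤ l2norm (u - v) := l2norm_le_of_le fun y => by
    simp only [u', v', Pi.sub_apply]; split_ifs <;> simp
  have ht : l2norm u' ≤ l2norm v' + l2norm (u' - v') := by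
    simpa using l2norm_add_le v' (u' - v')
  nlinarith [l2norm_nonneg u', l2norm_nonneg v', l2norm_nonneg (u' - v')]

variable {pos : Fin n ↪ Fin N} {a : EuclideanSpace ℂ (Bits (Ancilla pos))}

lemma outputProb_nonneg (C : Circuit N d) (out : Fin N) (x : Bits (Fin n)) (b : Fin 2) :
    0 ≤ outputProb C pos a out x b :=
  Finset.sum_nonneg fun _ _ => by positivity

lemma outputProb_add (C : Circuit N d) (ha : ‖a‖ = 1) (out : Fin N) (x : Bits (Fin n)) :
    outputProb C pos a out x 0 + outputProb C pos a out x 1 = 1 := by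
  have h : ∀ y : Bits (Fin N), y out = 1 ↔ ¬ y out = 0 := fun y => by
    generalize y out = b
    revert b
    decide
  unfold outputProb
  simp only [h]
  rw [Finset.sum_filter_add_sum_filter_not, ← l2norm_sq, l2norm_mulVec C.toMatrix_mem,
    l2norm_initialState, ha, one_pow]

lemma outputProb_le_one (C : Circuit N d) (ha : ‖a‖ = 1) (out : Fin N) (x : Bits (Fin n))
    (b : Fin 2) : outputProb C pos a out x b ≤ 1 := by
  have h := outputProb_add C ha out x
  have h0 := outputProb_nonneg (a := a) C out x 0
  have h1 := outputProb_nonneg (a := a) C out x 1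
  fin_cases b <;> simp <;> linarith

lemma successProb_le_one (C : Circuit N d) (ha : ‖a‖ = 1) (out : Fin N)
    (h : Bits (Fin n) → Fin 2) : successProb C pos a out h ≤ 1 := by
  rw [successProb, div_le_one (by positivity)]
  refine (Finset.sum_le_sum fun x _ => outputProb_le_one C ha out x (h x)).trans_eq ?_
  simp [Bits]

theorem successProb_le_prune (C : Circuit N d) (ha : ‖a‖ = 1) (out : Fin N) (k : ℕ)
    (h : Bits (Fin n) → Fin 2) :
    successProb C pos a out h ≤
      successProb (C.prune pos k) pos a out h + 4 * d * √(n / 2 ^ k) := by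
  have hunit : ∀ {d' : ℕ} (C' : Circuit N d') (x : Bits (Fin n)),
      l2norm (C'.toMatrix.mulVec (initialState pos a x)) = 1 := fun C' x => by
    rw [l2norm_mulVec C'.toMatrix_mem, l2norm_initialState, ha]
  have hx : ∀ x, outputProb C pos a out x (h x) ≤ outputProb (C.prune pos k) pos a out x (h x) +
      2 * l2norm (C.toMatrix.mulVec (initialState pos a x) -
        (C.prune pos k).toMatrix.mulVec (initialState pos a x)) :=
    fun x => sum_filter_norm_sq_le _ (hunit C x) (hunit _ x)
  have hsum := Finset.sum_le_sum fun x (_ : x ∈ Finset.univ) => hx x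
  rw [Finset.sum_add_distrib, ← Finset.mul_sum] at hsum
  have := C.sum_prune_sub_le k a ha
  rw [successProb, successProb, div_add' _ _ _ (by positivity)]
  gcongr
  linarith

lemma initialState_add_single (a : EuclideanSpace ℂ (Bits (Ancilla pos))) (x : Bits (Fin n))
    (i : Fin n) (y : Bits (Fin N)) :
    initialState pos a (x + Pi.single i 1) (y + Pi.single (pos i) 1) = initialState pos a x y := by
  have h1 : (∀ j, (y + Pi.single (pos i) 1 : Bits (Fin N)) (pos j) =
      (x + Pi.single i 1 : Bits (Fin n)) j) ↔
      ∀ j, y (pos j) = x j := by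
    refine forall_congr' fun j => ?_
    have : (Pi.single (pos i) 1 : Bits (Fin N)) (pos j) = (Pi.single i 1 : Bits (Fin n)) j := by
      simp [Pi.single_apply]
    rw [Pi.add_apply, Pi.add_apply, this, add_left_inj]
  have h2 : (fun q : Ancilla pos => (y + Pi.single (pos i) 1 : Bits (Fin N)) q.1) = fun q => y q.1 := by
    funext q
    rw [Pi.add_apply, Pi.single_eq_of_ne fun h => q.2 i h.symm, add_zero]
  simp only [initialState, h1, h2]

lemma mulVec_initialState_add_single {B : Matrix (Bits (Fin N)) (Bits (Fin N)) ℂ}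
    {K : Set (Fin N)} (hB : IsLocal Kᶜ B) (a : EuclideanSpace ℂ (Bits (Ancilla pos)))
    (x : Bits (Fin n)) {i : Fin n} (hi : pos i ∈ K) (y : Bits (Fin N)) :
    B.mulVec (initialState pos a (x + Pi.single i 1)) (y + Pi.single (pos i) 1) =
      B.mulVec (initialState pos a x) y := by
  simp only [Matrix.mulVec, dotProduct]
  refine (Equiv.sum_comp (Equiv.addRight (Pi.single (pos i) 1)) _).symm.trans
    (Finset.sum_congr rfl fun u _ => ?_)
  rw [Equiv.coe_addRight, initialState_add_single, hB.2]
  intro q hq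
  refine Pi.single_eq_of_ne (fun h => hq ?_) _
  rwa [h]

/-- `A` is unitary and commutes with the measurement projector, so it can be dropped. `B` commutes
with flipping the qubit `pos i`, and this flip does not affect the measured qubit. -/
lemma outputProb_eq_of_isLocal (C : Circuit N d) (out : Fin N) {T K : Set (Fin N)}
    (hout : out ∉ T) (hKT : K ⊆ T) {A B : Matrix (Bits (Fin N)) (Bits (Fin N)) ℂ}
    (hA : A ∈ Matrix.unitaryGroup (Bits (Fin N)) ℂ) (hA' : IsLocal T A) (hB' : IsLocal Kᶜ B)
    (hC : C.toMatrix = A * B) {i : Fin n} (hi : pos i ∈ K) (x : Bits (Fin n)) (b : Fin 2) :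
    outputProb C pos a out (x + Pi.single i 1) b = outputProb C pos a out x b := by
  have key : ∀ x, outputProb C pos a out x b =
      ∑ y : Bits (Fin N) with y out = b, ‖B.mulVec (initialState pos a x) y‖ ^ 2 := by
    intro x
    have hD : ∀ v : Bits (Fin N) → ℂ, (fun y => if y out = b then v y else 0) =
        (Matrix.diagonal fun y : Bits (Fin N) => if y out = b then (1 : ℂ) else 0).mulVec v := by
      intro v
      funext y
      rw [Matrix.mulVec_diagonal]
      split_ifs <;> simp
    have hcomm := hA'.commute (IsLocal.diagonal (S := {out})
      (f := fun y : Bits (Fin N) => if y out = b then (1 : ℂ) else 0)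
      fun y x h => by rw [h out rfl]) (Set.disjoint_singleton_right.mpr hout)
    rw [outputProb, sum_filter_norm_sq, sum_filter_norm_sq, hD (C.toMatrix.mulVec _),
      hD (B.mulVec _), hC, ← Matrix.mulVec_mulVec, Matrix.mulVec_mulVec _ _ A, ← hcomm,
      ← Matrix.mulVec_mulVec, l2norm_mulVec hA]
  rw [key, key]
  have hne : out ≠ pos i := fun h => hout (h ▸ hKT hi)
  refine Finset.sum_nbij' (· + Pi.single (pos i) 1) (· + Pi.single (pos i) 1) ?_ ?_ ?_ ?_ ?_
  · intro y hy
    simpa [Pi.single_eq_of_ne hne] using hy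
  · intro y hy
    simpa [Pi.single_eq_of_ne hne] using hy
  · intro y _
    rw [add_assoc, ← Pi.single_add]
    simp
  · intro y _
    rw [add_assoc, ← Pi.single_add]
    simp
  · intro y _
    rw [← mulVec_initialState_add_single hB' a (x + Pi.single i 1) hi, add_assoc x, ← Pi.single_add]
    simp

/-- The output of a pruned circuit ignores one of the input bits. -/
theorem exists_outputProb_prune_eq (C : Circuit N d) (out : Fin N) {k : ℕ} (hk : 0 < k)
    (hn : 2 * (k * 3 ^ d) + 1 ≤ n) :
    ∃ i, ∀ x b, outputProb (C.prune pos k) pos a out (x + Pi.single i 1) b =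
      outputProb (C.prune pos k) pos a out x b := by
  have key : ∀ l r, out ∉ (seg l r : Set (Fin N)) → k * 3 ^ d ≤ inputCount pos (seg l r) →
      ∃ i, ∀ x b, outputProb (C.prune pos k) pos a out (x + Pi.single i 1) b =
        outputProb (C.prune pos k) pos a out x b := by
    intro l r hout hlr
    obtain ⟨l', r', hl, hr, hc, A, hA, B, hB, hA', hB', h⟩ := C.exists_isLocal_prune pos k l r
    have hsub : (seg l' r' : Set (Fin N)) ⊆ seg l r := by
      intro q hq
      simp only [seg, Set.mem_ofPred_eq] at hq ⊢
      omega
    have hpos : inputCount pos (seg l' r') ≠ 0 := by omega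
    obtain ⟨i, hi⟩ := Set.nonempty_of_ncard_ne_zero hpos
    exact ⟨i, fun x b => outputProb_eq_of_isLocal _ out hout hsub hA hA' hB' h hi x b⟩
  have hall : inputCount pos (Set.univ : Set (Fin N)) = n := by simp [inputCount]
  have hone : inputCount pos {out} ≤ 1 := by
    refine (Set.ncard_le_one_iff (Set.toFinite _)).mpr fun {i j} hi hj => pos.injective ?_
    exact (Set.mem_singleton_iff.mp hi).trans (Set.mem_singleton_iff.mp hj).symm
  -- The output qubit itself may hold one input. By `hn`, one of its two sides then holds at least
  -- `k * 3 ^ d` inputs, of which at least `k > 0` survive in the inner interval.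
  have hcover : n ≤ inputCount pos (seg 0 out) + 1 + inputCount pos (seg (out + 1) N) := by
    have hu : (Set.univ : Set (Fin N)) = seg 0 out ∪ {out} ∪ seg (out + 1) N := by
      ext q
      simp only [seg, Set.mem_univ, Set.mem_union, Set.mem_ofPred_eq, Set.mem_singleton_iff,
        Fin.ext_iff, true_iff]
      omega
    rw [hu] at hall
    have h1 := inputCount_union_le pos (seg 0 (out : ℕ) ∪ {out}) (seg (out + 1) N)
    have h2 := inputCount_union_le pos (seg 0 (out : ℕ)) {out}
    omega
  by_cases h : k * 3 ^ d ≤ inputCount pos (seg 0 (out : ℕ))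
  · exact key _ _ (by simp [seg]) h
  · exact key (out + 1) N (by simp [seg]) (by omega)

end output

/-! ### Central binomial estimates -/

lemma sixteen_pow_le_centralBinom_sq (m : ℕ) : 16 ^ m ≤ (4 * m + 1) * m.centralBinom ^ 2 := by
  induction m with
  | zero => simp
  | succ m ih =>
    have h := Nat.succ_mul_centralBinom_succ m
    refine Nat.le_of_mul_le_mul_left ?_ (pow_pos m.succ_pos 2)
    calc (m + 1) ^ 2 * 16 ^ (m + 1) = 16 * (m + 1) ^ 2 * 16 ^ m := by ring
      _ ≤ 16 * (m + 1) ^ 2 * ((4 * m + 1) * m.centralBinom ^ 2) := Nat.mul_le_mul_left _ ih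
      _ = 4 * (4 * (4 * m + 1) * (m + 1) ^ 2) * m.centralBinom ^ 2 := by ring
      _ ≤ 4 * ((4 * (m + 1) + 1) * (2 * m + 1) ^ 2) * m.centralBinom ^ 2 := by
        refine Nat.mul_le_mul_right _ (Nat.mul_le_mul_left _ ?_)
        -- The two sides differ by exactly 1, which is why the factor `4 * m + 1` goes through the
        -- induction.
        nlinarith
      _ = (4 * (m + 1) + 1) * (2 * (2 * m + 1) * m.centralBinom) ^ 2 := by ring
      _ = (m + 1) ^ 2 * ((4 * (m + 1) + 1) * (m + 1).centralBinom ^ 2) := by rw [← h]; ring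

lemma four_pow_le_choose_half_sq {n : ℕ} (hn : 1 ≤ n) :
    4 ^ n ≤ 16 * n * ((n - 1).choose ((n - 1) / 2)) ^ 2 := by
  obtain ⟨m, rfl | rfl⟩ : ∃ m, n = 2 * m + 1 ∨ n = 2 * m + 2 := ⟨(n - 1) / 2, by omega⟩
  · have h1 : (2 * m + 1 - 1) / 2 = m := by omega
    rw [h1, Nat.add_sub_cancel, ← Nat.centralBinom_eq_two_mul_choose]
    have := sixteen_pow_le_centralBinom_sq m
    calc 4 ^ (2 * m + 1) = 4 * 16 ^ m := by rw [pow_succ, pow_mul]; norm_num [mul_comm]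
      _ ≤ 4 * ((4 * m + 1) * m.centralBinom ^ 2) := Nat.mul_le_mul_left _ this
      _ ≤ 16 * (2 * m + 1) * m.centralBinom ^ 2 := by
        rw [← mul_assoc]
        exact Nat.mul_le_mul_right _ (by omega)
  · have h1 : (2 * m + 2 - 1) / 2 = m := by omega
    have h2 : 2 * m + 2 - 1 = 2 * m + 1 := by omega
    rw [h1, h2]
    have h3 : (m + 1).centralBinom = 2 * (2 * m + 1).choose m := by
      rw [Nat.centralBinom_eq_two_mul_choose, Nat.mul_succ, Nat.choose_succ_succ,
        Nat.choose_symm_half]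
      ring
    have := sixteen_pow_le_centralBinom_sq (m + 1)
    rw [h3] at this
    calc 4 ^ (2 * m + 2) = 16 ^ (m + 1) := by
          rw [show 2 * m + 2 = 2 * (m + 1) by ring, pow_mul]; norm_num
      _ ≤ (4 * (m + 1) + 1) * (2 * (2 * m + 1).choose m) ^ 2 := this
      _ = 4 * (4 * (m + 1) + 1) * (2 * m + 1).choose m ^ 2 := by ring
      _ ≤ 16 * (2 * m + 2) * (2 * m + 1).choose m ^ 2 := Nat.mul_le_mul_right _ (by omega)

/-! ### Pivotal inputs of majority -/

section majority

variable {n : ℕ}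

/-- The string whose ones are at the elements of `s`. -/
def indicatorBits (s : Finset (Fin n)) : Bits (Fin n) := fun j => if j ∈ s then 1 else 0

lemma indicatorBits_injective : Function.Injective (indicatorBits (n := n)) := by
  intro s t h
  ext j
  have := congrFun h j
  simp only [indicatorBits] at this
  by_cases hs : j ∈ s <;> by_cases ht : j ∈ t <;> simp [hs, ht] at this ⊢

lemma indicatorBits_insert {s : Finset (Fin n)} {i : Fin n} (hi : i ∉ s) :
    indicatorBits (insert i s) = indicatorBits s + Pi.single i 1 := by
  funext j
  by_cases hj : j = i
  · subst hj; simp [indicatorBits, hi]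
  · simp [indicatorBits, hj]

lemma majority_indicatorBits (s : Finset (Fin n)) :
    majority n (indicatorBits s) = if n ≤ 2 * s.card then 1 else 0 := by
  have h : ∑ i, ((indicatorBits s i : ℕ) : ℝ) = s.card := by
    have : ∀ i, ((indicatorBits s i : ℕ) : ℝ) = if i ∈ s then 1 else 0 := by
      intro i
      by_cases hi : i ∈ s <;> simp [indicatorBits, hi]
    simp [this]
  have h' : (n : ℝ) / 2 ≤ s.card ↔ n ≤ 2 * s.card := by
    rw [div_le_iff₀' two_pos]
    exact_mod_cast Iff.rfl
  simp only [majority, h, h']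

lemma add_single_add_single (x : Bits (Fin n)) (i : Fin n) :
    x + Pi.single i 1 + Pi.single i 1 = x := by
  rw [add_assoc, ← Pi.single_add]
  simp

/-- A lower bound on the number of strings at which bit `i` is pivotal for the majority. -/
lemma two_mul_choose_le_card_pivotal (i : Fin n) :
    2 * (n - 1).choose ((n - 1) / 2) ≤
      (Finset.univ.filter fun x => majority n x ≠ majority n (x + Pi.single i 1)).card := by
  classical
  -- With `(n - 1) / 2` ones outside `i`, the string is just below the threshold for either parity
  -- of `n`. Both it and its flip at `i` are counted, hence the factor 2.
  set P := Finset.powersetCard ((n - 1) / 2) (Finset.univ.erase i) with hP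
  have hn : 1 ≤ n := i.pos
  have hmem : ∀ s ∈ P, i ∉ s ∧ s.card = (n - 1) / 2 := by
    intro s hs
    rw [hP, Finset.mem_powersetCard] at hs
    exact ⟨fun h => Finset.notMem_erase i _ (hs.1 h), hs.2⟩
  have hmaj : ∀ s ∈ P, majority n (indicatorBits s) ≠ majority n (indicatorBits (insert i s)) := by
    intro s hs
    obtain ⟨his, hcard⟩ := hmem s hs
    rw [majority_indicatorBits, majority_indicatorBits, Finset.card_insert_of_notMem his,
      if_neg (by omega), if_pos (by omega)]
    exact zero_ne_one
  have hinj : Set.InjOn (fun s => indicatorBits (insert i s)) P := by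
    intro s hs t ht hst
    have h := indicatorBits_injective hst
    rw [← Finset.erase_insert (hmem s hs).1, ← Finset.erase_insert (hmem t ht).1, h]
  have hdisj : Disjoint (P.image indicatorBits) (P.image fun s => indicatorBits (insert i s)) := by
    rw [Finset.disjoint_left]
    intro x hx hx'
    obtain ⟨s, hs, rfl⟩ := Finset.mem_image.mp hx
    obtain ⟨t, ht, hst⟩ := Finset.mem_image.mp hx'
    have := indicatorBits_injective hst
    exact (hmem s hs).1 (this ▸ Finset.mem_insert_self i t)
  have hcard : P.card = (n - 1).choose ((n - 1) / 2) := by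
    rw [hP, Finset.card_powersetCard, Finset.card_erase_of_mem (Finset.mem_univ i),
      Finset.card_univ, Fintype.card_fin]
  rw [two_mul, ← hcard]
  nth_rewrite 1 [← Finset.card_image_of_injective P indicatorBits_injective]
  rw [← Finset.card_image_of_injOn hinj, ← Finset.card_union_of_disjoint hdisj]
  refine Finset.card_le_card (Finset.union_subset ?_ ?_) <;> intro x hx <;>
    obtain ⟨s, hs, rfl⟩ := Finset.mem_image.mp hx <;>
    simp only [Finset.mem_filter, Finset.mem_univ, true_and]
  · rw [← indicatorBits_insert (hmem s hs).1]
    exact hmaj s hs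
  · rw [indicatorBits_insert (hmem s hs).1, add_single_add_single,
      ← indicatorBits_insert (hmem s hs).1]
    exact (hmaj s hs).symm

end majority

/-- Pair `x` with its flip at `i`. The output distribution is the same on both, so when `i` is
pivotal the two success probabilities sum to 1 instead of at most 2. -/
lemma successProb_majority_le {n N d : ℕ} {pos : Fin n ↪ Fin N}
    {a : EuclideanSpace ℂ (Bits (Ancilla pos))} (ha : ‖a‖ = 1) (C : Circuit N d) (out : Fin N)
    {i : Fin n} (hi : ∀ x b, outputProb C pos a out (x + Pi.single i 1) b =
      outputProb C pos a out x b) :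
    successProb C pos a out (majority n) ≤ 1 - 1 / 4 * √(1 / n) := by
  have hn : 1 ≤ n := i.pos
  set p := fun x b => outputProb C pos a out x b with hp
  set piv := Finset.univ.filter fun x => majority n x ≠ majority n (x + Pi.single i 1) with hpiv
  have hpair : ∀ x, p x (majority n x) + p x (majority n (x + Pi.single i 1)) ≤
      2 - if majority n x ≠ majority n (x + Pi.single i 1) then 1 else 0 := by
    intro x
    have h01 := outputProb_add C ha out x
    split_ifs with h
    · have : ∀ b c : Fin 2, b ≠ c → p x b + p x c = p x 0 + p x 1 := by
        intro b c hbc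
        fin_cases b <;> fin_cases c <;> simp_all [add_comm]
      rw [this _ _ h]
      simp only [hp]
      linarith
    · have := outputProb_le_one C ha out x
      simp only [hp]
      linarith [this (majority n x), this (majority n (x + Pi.single i 1))]
  have hsum : 2 * ∑ x, p x (majority n x) ≤ 2 * 2 ^ n - piv.card := by
    have hflip : ∑ x, p x (majority n (x + Pi.single i 1)) = ∑ x, p x (majority n x) := by
      rw [← Equiv.sum_comp (Equiv.addRight (Pi.single i 1)) fun x => p x (majority n x)]
      exact Finset.sum_congr rfl fun x _ => (hi x _).symm
    have := Finset.sum_le_sum fun x (_ : x ∈ Finset.univ) => hpair x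
    rw [Finset.sum_add_distrib, hflip, Finset.sum_sub_distrib, Finset.sum_boole] at this
    simp only [Finset.sum_const, Finset.card_univ, Fintype.card_pi, Fintype.card_fin,
      Finset.prod_const, nsmul_eq_mul, Nat.cast_pow, Nat.cast_ofNat] at this
    linarith
  have hcard : (2 : ℝ) ^ n ≤ 2 * √n * piv.card := by
    have h1 : (2 * (n - 1).choose ((n - 1) / 2) : ℝ) ≤ piv.card := by
      exact_mod_cast two_mul_choose_le_card_pivotal i
    have h2 : ((4 : ℝ) ^ n) ≤ 16 * n * ((n - 1).choose ((n - 1) / 2) : ℝ) ^ 2 := by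
      exact_mod_cast four_pow_le_choose_half_sq hn
    refine le_trans (le_of_sq_le_sq (b := 2 * √n * (2 * (n - 1).choose ((n - 1) / 2)))
      ?_ (by positivity)) (mul_le_mul_of_nonneg_left h1 (by positivity))
    calc ((2 : ℝ) ^ n) ^ 2 = 4 ^ n := by rw [← pow_mul, mul_comm, pow_mul]; norm_num
      _ ≤ _ := h2
      _ = _ := by
        rw [mul_pow, mul_pow, Real.sq_sqrt (Nat.cast_nonneg n)]
        ring
  have hs : 0 < √(n : ℝ) := Real.sqrt_pos.mpr (by exact_mod_cast hn)
  have hlow : 1 / (2 * √n) * 2 ^ n ≤ (piv.card : ℝ) := by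
    rw [div_mul_eq_mul_div, one_mul, div_le_iff₀' (by positivity)]
    exact hcard
  rw [successProb, div_le_iff₀ (by positivity), Real.sqrt_div zero_le_one, Real.sqrt_one]
  have : 1 / 4 * (1 / √(n : ℝ)) = 1 / 2 * (1 / (2 * √n)) := by field_simp; norm_num
  rw [this]
  simp only [hp] at hsum
  linarith

/-! ### Choice of the pruning parameter -/

lemma mul_succ_sq_le_two_pow {k : ℕ} (hk : 30 ≤ k) : 36864 * (k + 1) ^ 2 ≤ 2 ^ k := by
  induction k, hk using Nat.le_induction with
  | base => norm_num
  | succ k hk ih =>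
    have h : (k + 1 + 1) ^ 2 ≤ 2 * (k + 1) ^ 2 := by nlinarith
    rw [pow_succ 2]
    linarith

/-- If the bound of the theorem is nontrivial, then some pruning parameter works. -/
lemma exists_prune_parameter {n d : ℕ} (hn : 1 ≤ n) (hd : 1 ≤ d)
    (h : 2 * √2 * d * (2 : ℝ) ^ (-((n : ℝ) ^ (1 / (d : ℝ))) / 6) < 1 / 2 ^ 32 * √(1 / n)) :
    ∃ k, 0 < k ∧ 2 * (k * 3 ^ d) + 1 ≤ n ∧ (1024 * d ^ 2 * n ^ 2 : ℝ) ≤ 2 ^ k := by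
  set t : ℝ := (n : ℝ) ^ (1 / (d : ℝ)) with ht
  have hn' : (1 : ℝ) ≤ n := by exact_mod_cast hn
  have hd' : (1 : ℝ) ≤ d := by exact_mod_cast hd
  have hs : 1 ≤ √(n : ℝ) := Real.one_le_sqrt.mpr hn'
  have htd : t ^ d = n := by
    rw [ht, one_div, Real.rpow_inv_natCast_pow (by positivity) (by omega)]
  have hbig : 2 ^ 32 * (d * √n) ≤ (2 : ℝ) ^ (t / 6) := by
    have h2 : 1 ≤ √(2 : ℝ) := Real.one_le_sqrt.mpr one_le_two
    rw [neg_div, Real.rpow_neg zero_le_two, Real.sqrt_div zero_le_one, Real.sqrt_one,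
      ← div_eq_mul_inv, div_mul_div_comm, one_mul, div_lt_div_iff₀ (by positivity) (by positivity),
      one_mul] at h
    refine le_trans ?_ h.le
    have : (1 : ℝ) * d ≤ 2 * √2 * d := by gcongr; linarith
    nlinarith [mul_le_mul_of_nonneg_right this (by positivity : 0 ≤ 2 ^ 32 * √(n : ℝ))]
  have hds : 1 ≤ d * √(n : ℝ) := one_le_mul_of_one_le_of_one_le hd' hs
  -- Here `192 = 6 * 32`, from the factor `2 ^ 32` in `hbig`.
  have ht192 : 192 ≤ t := by
    have : (2 : ℝ) ^ (32 : ℝ) ≤ 2 ^ (t / 6) := by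
      refine le_trans ?_ hbig
      rw [show (32 : ℝ) = (32 : ℕ) by norm_num, Real.rpow_natCast]
      exact le_mul_of_one_le_right (by positivity) hds
    have := (Real.rpow_le_rpow_left_iff one_lt_two).mp this
    linarith
  rcases hd.eq_or_lt with rfl | hd2
  · have hn192 : 192 ≤ n := by
      rw [pow_one] at htd
      rw [htd] at ht192
      exact_mod_cast ht192
    -- For depth 1 this is the largest `k` with `2 * (k * 3) + 1 ≤ n`. The constant in
    -- `mul_succ_sq_le_two_pow` is `36864 = 1024 * 6 ^ 2`.
    refine ⟨(n - 1) / 6, by omega, by omega, ?_⟩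
    have h1 := mul_succ_sq_le_two_pow (k := (n - 1) / 6) (by omega)
    have h2 : n ≤ 6 * ((n - 1) / 6 + 1) := by omega
    have h3 : 1024 * n ^ 2 ≤ 2 ^ ((n - 1) / 6) := by
      refine le_trans ?_ h1
      calc 1024 * n ^ 2 ≤ 1024 * (6 * ((n - 1) / 6 + 1)) ^ 2 := by gcongr
        _ = 36864 * ((n - 1) / 6 + 1) ^ 2 := by ring
    have h4 : ((1024 * n ^ 2 : ℕ) : ℝ) ≤ ((2 ^ ((n - 1) / 6) : ℕ) : ℝ) := Nat.cast_le.mpr h3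
    push_cast at h4 ⊢
    linarith
  -- The exponent `2 * t / 3 = 4 * (t / 6)` makes `2 ^ k` dominate the fourth power of `hbig`, which
  -- supplies the `n ^ 2`. There is room for it since `d ≥ 2` gives `(t / 3) ^ d ≥ (t / 3) ^ 2`,
  -- quadratic in `t`.
  · refine ⟨⌈2 * t / 3⌉₊, Nat.ceil_pos.mpr (by positivity), ?_, ?_⟩
    · have hk : (⌈2 * t / 3⌉₊ : ℝ) ≤ 2 * t / 3 + 1 :=
        (Nat.ceil_lt_add_one (by positivity)).le
      have h9 : (t / 3) ^ 2 ≤ (t / 3) ^ d := pow_le_pow_right₀ (by linarith) hd2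
      have h3 : (1 : ℝ) ≤ 3 ^ d := one_le_pow₀ (by norm_num)
      have hfin : (2 * (⌈2 * t / 3⌉₊ * 3 ^ d) + 1 : ℝ) ≤ n := by
        calc (2 * (⌈2 * t / 3⌉₊ * 3 ^ d) + 1 : ℝ)
            ≤ 2 * ((2 * t / 3 + 1) * 3 ^ d) + 3 ^ d := by gcongr
          _ = (4 * t / 3 + 3) * 3 ^ d := by ring
          _ ≤ (t / 3) ^ d * 3 ^ d := by
              gcongr
              nlinarith
          _ = n := by rw [← mul_pow, div_mul_cancel₀ _ three_ne_zero, htd]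
      exact_mod_cast hfin
    · calc (1024 * d ^ 2 * n ^ 2 : ℝ) ≤ (2 ^ 32 * (d * √n)) ^ 4 := by
            have e : (2 ^ 32 * (d * √n)) ^ 4 = 2 ^ 128 * (d : ℝ) ^ 4 * n ^ 2 := by
              have : √(n : ℝ) ^ 4 = n ^ 2 := by
                rw [show (4 : ℕ) = 2 * 2 by norm_num, pow_mul, Real.sq_sqrt (by positivity)]
              rw [mul_pow, mul_pow, this]
              ring
            rw [e]
            gcongr
            · norm_num
            · norm_num
        _ ≤ ((2 : ℝ) ^ (t / 6)) ^ 4 := by gcongr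
        _ = (2 : ℝ) ^ (2 * t / 3) := by
            rw [← Real.rpow_mul_natCast zero_le_two]
            congr 1
            push_cast
            ring
        _ ≤ (2 : ℝ) ^ (⌈2 * t / 3⌉₊ : ℝ) :=
            Real.rpow_le_rpow_of_exponent_le one_le_two (Nat.le_ceil _)
        _ = 2 ^ ⌈2 * t / 3⌉₊ := Real.rpow_natCast _ _

end OneDimQAC

theorem mainTheorem8 :
    ∃ c : ℝ, 0 < c ∧
      ∀ (n d : ℕ), 1 ≤ n → 1 ≤ d →
      ∀ (N : ℕ) (pos : Fin n ↪ Fin N)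
        (a : EuclideanSpace ℂ (OneDimQAC.Bits (OneDimQAC.Ancilla pos))), ‖a‖ = 1 →
      ∀ (C : OneDimQAC.Circuit N d) (out : Fin N),
        OneDimQAC.successProb C pos a out (OneDimQAC.majority n) ≤
          1 - c * Real.sqrt (1 / (n : ℝ)) +
            2 * Real.sqrt 2 * (d : ℝ) * (2 : ℝ) ^ (-((n : ℝ) ^ (1 / (d : ℝ))) / 6) := by
  refine ⟨1 / 2 ^ 32, by positivity, fun n d hn hd N pos a ha C out => ?_⟩
  -- If the error term outweighs the gain, the claimed bound is at least 1. The tiny constant makes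
  -- the remaining case force `n ^ (1 / d)` to be large.
  rcases le_or_gt (1 / 2 ^ 32 * √(1 / (n : ℝ)))
    (2 * √2 * (d : ℝ) * (2 : ℝ) ^ (-((n : ℝ) ^ (1 / (d : ℝ))) / 6)) with h | h
  · have := OneDimQAC.successProb_le_one C ha out (OneDimQAC.majority n)
    linarith
  · obtain ⟨k, hk, hkn, hk2⟩ := OneDimQAC.exists_prune_parameter hn hd h
    obtain ⟨i, hi⟩ := OneDimQAC.exists_outputProb_prune_eq (pos := pos) (a := a) C out hk hkn
    have h1 := OneDimQAC.successProb_le_prune C ha out k (OneDimQAC.majority n)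
    have h2 := OneDimQAC.successProb_majority_le ha _ out hi
    have hn' : (0 : ℝ) < n := by exact_mod_cast hn
    -- Pruning may use up half of the loss `1 / 4 * √(1 / n)`; squared, this is the requirement
    -- `1024 * d ^ 2 * n ^ 2 ≤ 2 ^ k`.
    have h3 : 4 * d * √(n / 2 ^ k) ≤ 1 / 8 * √(1 / (n : ℝ)) := by
      refine le_of_sq_le_sq ?_ (by positivity)
      rw [mul_pow, mul_pow, Real.sq_sqrt (by positivity), mul_pow, Real.sq_sqrt (by positivity),
        mul_div_assoc', mul_one_div, div_le_div_iff₀ (by positivity) hn']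
      linarith
    have h4 : 0 ≤ √(1 / (n : ℝ)) := Real.sqrt_nonneg _
    have h5 : 0 ≤ 2 * √2 * (d : ℝ) * (2 : ℝ) ^ (-((n : ℝ) ^ (1 / (d : ℝ))) / 6) := by positivity
    linarith
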